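/- For permutations $\tau\in S_k$ and $\sigma\in S_n$, say that $\tau$ appears as a pattern in $\sigma$ if there are positions $i_1<\cdots<i_k$ such that $\sigma_{i_s}<\sigma_{i_t}$ if and only if $\tau_s<\tau_t$ for all $1\le s,t\le k$. Let $S_n(312,\tau)$ be the set of permutations of length $n$ in which neither $312$ nor $\tau$ appears as a pattern, let $L_n(\sigma)$ be the length of a longest increasing subsequence of $\sigma$ (so $L_0=0$ for the empty permutation), and put $$F_\tau(x,q)=\sum_{n\ge 0}\ \sum_{\sigma\in S_n(312,\tau)} x^n q^{L_n(\sigma)},$$ a formal power series in $x$ whose coefficients are polynomials in $q$. Then $F_1(x,q)=1$, and for all $m\ge 2$, $$F_{12\cdots m}(x,q)=1+\frac{qx}{1-x}+\sum_{j=2}^{m-1}\left(\frac{q^jx^j}{(1-x)^{2j-1}}\sum_{k=1}^{j-1}N(j-1,k)\,x^{k-1}\right),$$ where $N(n,k)=\frac1n\binom{n}{k}\binom{n}{k-1}$ $(1\le k\le n)$ are the Narayana numbers and the sum over $j$ is empty for $m=2$. -/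

import Mathlib

namespace PatternAvoidance

/-- The pattern `τ ∈ S_k` appears in `σ ∈ S_n`: there are positions `f 0 < ⋯ < f (k-1)` at which
the values of `σ` have the same relative order as the values of `τ`. -/
def Contains {k n : ℕ} (τ : Equiv.Perm (Fin k)) (σ : Equiv.Perm (Fin n)) : Prop :=
  ∃ f : Fin k → Fin n, StrictMono f ∧ ∀ s t : Fin k, σ (f s) < σ (f t) ↔ τ s < τ t

/-- The permutation with one-line notation `312` (written with the letters `0, 1, 2`). -/
def perm312 : Equiv.Perm (Fin 3) where
  toFun := ![2, 0, 1]
  invFun := ![1, 2, 0]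
  left_inv := by decide
  right_inv := by decide

/-- The increasing pattern `12⋯m`. -/
def increasing (m : ℕ) : Equiv.Perm (Fin m) := Equiv.refl (Fin m)

open Classical in
/-- `S_n(312, τ)`: the permutations of length `n` that avoid both `312` and `τ`. -/
noncomputable def avoiders {k : ℕ} (τ : Equiv.Perm (Fin k)) (n : ℕ) :
    Finset (Equiv.Perm (Fin n)) :=
  Finset.univ.filter fun σ => ¬ Contains perm312 σ ∧ ¬ Contains τ σ

open Classical in
/-- `L_n(σ)`: the length of a longest increasing subsequence of `σ`, where a subsequence is given
by its set of positions. -/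
noncomputable def lis {n : ℕ} (σ : Equiv.Perm (Fin n)) : ℕ :=
  (Finset.univ.filter fun s : Finset (Fin n) => StrictMonoOn σ (s : Set (Fin n))).sup Finset.card

/-- `F_τ(x, q) = ∑_{n ≥ 0} ∑_{σ ∈ S_n(312, τ)} x^n q^{L_n(σ)}`, as a formal power series in `x`
whose coefficients are polynomials in `q`. -/
noncomputable def F {k : ℕ} (τ : Equiv.Perm (Fin k)) : PowerSeries (Polynomial ℚ) :=
  PowerSeries.mk fun n => ∑ σ ∈ avoiders τ n, (Polynomial.X : Polynomial ℚ) ^ lis σ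

/-- The variable `x`. -/
noncomputable def x : PowerSeries (Polynomial ℚ) := PowerSeries.X

/-- The variable `q`. -/
noncomputable def q : PowerSeries (Polynomial ℚ) := PowerSeries.C Polynomial.X

/-- The Narayana number `N(n, k) = (1/n) * C(n, k) * C(n, k-1)`, for `1 ≤ k ≤ n`. -/
def narayana (n k : ℕ) : ℚ := 1 / (n : ℚ) * (n.choose k : ℚ) * (n.choose (k - 1) : ℚ)

/-- `1 - x` is invertible, so that `Ring.inverse` of its powers is the genuine inverse. -/
theorem isUnit_one_sub_x : IsUnit (1 - x) := by
  rw [PowerSeries.isUnit_iff_constantCoeff]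
  simp [x]

end PatternAvoidance

namespace PatternAvoidance

open Finset

/-! ### Longest increasing subsequences and the two patterns -/

section Lis

variable {n : ℕ} {σ : Equiv.Perm (Fin n)}

/-! A permutation avoids `12⋯m` exactly when its longest increasing subsequence is shorter than `m`.
Hence `F` is the sum over `j < m` of `q^j G_j(x)`, where `G_j` (`lisSeries`) counts the 312-avoiders
with `lis = j`.

Cutting a 312-avoider at its minimum 0 gives the form `(α+1) 0 (β+a+1)` with `α`, `β` avoiding 312:
an entry before 0 exceeding one after it would form 312. An increasing subsequence uses either 0 or
part of `α`, followed by any increasing part of `β`, so `lis = max (lis α) 1 + lis β` (`lis_glue`).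
This yields `G_{j+1} = x G_j + x ∑ G_{a+1} G_{j-a}`, the sum over `0 ≤ a ≤ j` (`lisSeries_succ`).

The Narayana polynomials satisfy a matching convolution (`narayanaSeries_succ`), obtained from the
explicit binomials: they obey a three-term recurrence, which is a linear differential equation for
their generating function, which in turn forces a quadratic equation. Strong induction then gives
`(1-x)^(2j+1) G_{j+1} = x^(j+1) N_j(x)` (`lisSeries_mul_pow`). -/

theorem card_le_lis {s : Finset (Fin n)} (hs : StrictMonoOn σ (s : Set (Fin n))) :
    s.card ≤ lis σ := by
  classical
  unfold lis
  exact Finset.le_sup (f := Finset.card) (by simpa using hs)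

theorem exists_card_eq_lis (σ : Equiv.Perm (Fin n)) :
    ∃ s : Finset (Fin n), StrictMonoOn σ (s : Set (Fin n)) ∧ s.card = lis σ := by
  classical
  unfold lis
  obtain ⟨s, hs, h⟩ := Finset.exists_mem_eq_sup
    (Finset.univ.filter fun s : Finset (Fin n) => StrictMonoOn σ (s : Set (Fin n)))
    ⟨∅, by simp [StrictMonoOn]⟩ Finset.card
  exact ⟨s, by simpa using hs, by convert h.symm⟩

theorem contains_increasing_iff {m : ℕ} : Contains (increasing m) σ ↔ m ≤ lis σ := by
  constructor
  · rintro ⟨f, hf, h⟩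
    have hs : StrictMonoOn σ ((univ.image f : Finset (Fin n)) : Set (Fin n)) := by
      intro a ha b hb hab
      simp only [coe_image, coe_univ, Set.image_univ, Set.mem_range] at ha hb
      obtain ⟨s, rfl⟩ := ha
      obtain ⟨t, rfl⟩ := hb
      exact (h s t).2 (hf.lt_iff_lt.1 hab)
    have := card_le_lis hs
    rwa [card_image_of_injective _ hf.injective, card_univ, Fintype.card_fin] at this
  · intro h
    obtain ⟨s, hs, hc⟩ := exists_card_eq_lis σ
    obtain ⟨t, hts, htc⟩ := exists_subset_card_eq (hc ▸ h)
    refine ⟨t.orderEmbOfFin htc, (t.orderEmbOfFin htc).strictMono, fun a b => ?_⟩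
    have hm : ∀ a, t.orderEmbOfFin htc a ∈ (s : Set (Fin n)) := fun a =>
      hts (orderEmbOfFin_mem t htc a)
    rw [hs.lt_iff_lt (hm a) (hm b)]
    exact (t.orderEmbOfFin htc).lt_iff_lt

end Lis

theorem contains_perm312_iff {n : ℕ} {σ : Equiv.Perm (Fin n)} :
    Contains perm312 σ ↔ ∃ i j k, i < j ∧ j < k ∧ σ j < σ k ∧ σ k < σ i := by
  constructor
  · rintro ⟨f, hf, h⟩
    exact ⟨f 0, f 1, f 2, hf (by decide), hf (by decide), (h 1 2).2 (by decide),
      (h 2 0).2 (by decide)⟩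
  · rintro ⟨i, j, k, hij, hjk, h1, h2⟩
    refine ⟨![i, j, k], ?_, ?_⟩
    · rw [Fin.strictMono_iff_lt_succ]
      intro a
      fin_cases a
      · simpa using hij
      · simpa using hjk
    · intro s t
      have h3 := h1.trans h2
      fin_cases s <;> fin_cases t <;>
        simp [perm312, h1, h2, h3, h1.le, h2.le, h3.le]

/-! ### Decomposition of 312-avoiders at their minimum -/

section Glue

variable {a b : ℕ}

/-- One-line notation of `(α + 1) 0 (β + a + 1)`. -/
def glueFun (α : Equiv.Perm (Fin a)) (β : Equiv.Perm (Fin b)) (i : Fin (a + b + 1)) :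
    Fin (a + b + 1) :=
  if h : i.1 < a then ⟨(α ⟨i, h⟩).1 + 1, by omega⟩
  else if h' : i.1 = a then 0
  else ⟨a + 1 + (β ⟨i.1 - (a + 1), by omega⟩).1, by omega⟩

theorem glueFun_injective (α : Equiv.Perm (Fin a)) (β : Equiv.Perm (Fin b)) :
    Function.Injective (glueFun α β) := by
  intro i j h
  have hα : ∀ (i j : ℕ) (hi : i < a) (hj : j < a), (α ⟨i, hi⟩).1 = (α ⟨j, hj⟩).1 → i = j := by
    intro i j hi hj h
    simpa using α.injective (Fin.ext h)
  have hβ : ∀ (i j : ℕ) (hi : i < b) (hj : j < b), (β ⟨i, hi⟩).1 = (β ⟨j, hj⟩).1 → i = j := by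
    intro i j hi hj h
    simpa using β.injective (Fin.ext h)
  have h := congrArg Fin.val h
  apply Fin.ext
  unfold glueFun at h
  split_ifs at h <;> simp only [Fin.val_zero] at h
  · exact hα _ _ _ _ (by omega)
  all_goals first | omega | skip
  have := hβ _ _ _ _ (Nat.add_left_cancel h)
  omega

/-- The permutation `(α + 1) 0 (β + a + 1)`. -/
noncomputable def glue (α : Equiv.Perm (Fin a)) (β : Equiv.Perm (Fin b)) :
    Equiv.Perm (Fin (a + b + 1)) :=
  Equiv.ofBijective _ (Finite.injective_iff_bijective.1 (glueFun_injective α β))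

/-- The embedding of the positions before `a`. -/
def leftPos (a b : ℕ) : Fin a ↪ Fin (a + b + 1) where
  toFun i := ⟨i, by omega⟩
  inj' i j h := by simpa [Fin.ext_iff] using h

/-- The position `a`. -/
def midPos (a b : ℕ) : Fin (a + b + 1) := ⟨a, by omega⟩

/-- The embedding of the positions after `a`. -/
def rightPos (a b : ℕ) : Fin b ↪ Fin (a + b + 1) where
  toFun i := ⟨a + 1 + i, by omega⟩
  inj' i j h := by simpa [Fin.ext_iff] using h

theorem pos_cases (i : Fin (a + b + 1)) :
    (∃ j, i = leftPos a b j) ∨ i = midPos a b ∨ ∃ j, i = rightPos a b j := by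
  rcases lt_trichotomy i.1 a with h | h | h
  · exact Or.inl ⟨⟨i, h⟩, rfl⟩
  · exact Or.inr (Or.inl (Fin.ext h))
  · exact Or.inr (Or.inr ⟨⟨i - (a + 1), by omega⟩, Fin.ext (show i.1 = a + 1 + (i.1 - (a + 1)) by omega)⟩)

@[simp] theorem val_leftPos (i : Fin a) : (leftPos a b i).1 = i := rfl
@[simp] theorem val_midPos : (midPos a b).1 = a := rfl
@[simp] theorem val_rightPos (i : Fin b) : (rightPos a b i).1 = a + 1 + i := rfl

variable (α : Equiv.Perm (Fin a)) (β : Equiv.Perm (Fin b))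

@[simp] theorem val_glue_leftPos (i : Fin a) : (glue α β (leftPos a b i)).1 = α i + 1 := by
  simp [glue, glueFun]

@[simp] theorem glue_midPos : glue α β (midPos a b) = 0 := by
  simp [glue, glueFun]

@[simp] theorem val_glue_rightPos (i : Fin b) :
    (glue α β (rightPos a b i)).1 = a + 1 + β i := by
  have h1 : ¬ (a + 1 + i.1 < a) := by omega
  have h2 : ¬ (a + 1 + i.1 = a) := by omega
  simp [glue, glueFun, h1, h2]

theorem leftPos_ne_midPos (i : Fin a) : leftPos a b i ≠ midPos a b :=
  fun h => i.2.ne (congrArg Fin.val h)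

theorem rightPos_ne_midPos (i : Fin b) : rightPos a b i ≠ midPos a b := fun h => by
  have := congrArg Fin.val h
  rw [val_rightPos, val_midPos] at this
  omega

theorem rightPos_ne_leftPos (i : Fin b) (j : Fin a) : rightPos a b i ≠ leftPos a b j := fun h => by
  have := congrArg Fin.val h
  rw [val_rightPos, val_leftPos] at this
  omega

@[simp] theorem leftPos_lt_leftPos {i j : Fin a} : leftPos a b i < leftPos a b j ↔ i < j := Iff.rfl

@[simp] theorem rightPos_lt_rightPos {i j : Fin b} :
    rightPos a b i < rightPos a b j ↔ i < j := by
  rw [Fin.lt_def, Fin.lt_def, val_rightPos, val_rightPos, Nat.add_lt_add_iff_left]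

@[simp] theorem glue_leftPos_lt {i j : Fin a} :
    glue α β (leftPos a b i) < glue α β (leftPos a b j) ↔ α i < α j := by
  rw [Fin.lt_def, Fin.lt_def, val_glue_leftPos, val_glue_leftPos, Nat.add_lt_add_iff_right]

@[simp] theorem glue_rightPos_lt {i j : Fin b} :
    glue α β (rightPos a b i) < glue α β (rightPos a b j) ↔ β i < β j := by
  rw [Fin.lt_def, Fin.lt_def, val_glue_rightPos, val_glue_rightPos, Nat.add_lt_add_iff_left]

theorem contains_perm312_glue :
    Contains perm312 (glue α β) ↔ Contains perm312 α ∨ Contains perm312 β := by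
  simp only [contains_perm312_iff]
  constructor
  · rintro ⟨i, j, k, hij, hjk, h1, h2⟩
    rw [Fin.lt_def] at hij hjk h1 h2
    rcases pos_cases i with ⟨i, rfl⟩ | rfl | ⟨i, rfl⟩ <;>
    rcases pos_cases j with ⟨j, rfl⟩ | rfl | ⟨j, rfl⟩ <;>
    rcases pos_cases k with ⟨k, rfl⟩ | rfl | ⟨k, rfl⟩ <;>
    simp only [val_glue_leftPos, glue_midPos, val_glue_rightPos, val_leftPos, val_midPos,
      val_rightPos, Fin.val_zero] at hij hjk h1 h2 <;>
    first
    | omega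
    | exact Or.inl ⟨i, j, k, by rw [Fin.lt_def]; omega, by rw [Fin.lt_def]; omega,
        by rw [Fin.lt_def]; omega, by rw [Fin.lt_def]; omega⟩
    | exact Or.inr ⟨i, j, k, by rw [Fin.lt_def]; omega, by rw [Fin.lt_def]; omega,
        by rw [Fin.lt_def]; omega, by rw [Fin.lt_def]; omega⟩
  · rintro (⟨i, j, k, hij, hjk, h1, h2⟩ | ⟨i, j, k, hij, hjk, h1, h2⟩)
    · refine ⟨leftPos a b i, leftPos a b j, leftPos a b k, ?_⟩
      simpa using ⟨hij, hjk, h1, h2⟩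
    · refine ⟨rightPos a b i, rightPos a b j, rightPos a b k, ?_⟩
      simpa using ⟨hij, hjk, h1, h2⟩

theorem glue_injective {α α' : Equiv.Perm (Fin a)} {β β' : Equiv.Perm (Fin b)}
    (h : glue α β = glue α' β') : α = α' ∧ β = β' := by
  constructor
  · ext i
    have := congrArg (fun σ => (σ (leftPos a b i)).1) h
    simpa using this
  · ext i
    have := congrArg (fun σ => (σ (rightPos a b i)).1) h
    simpa using this

/-- Otherwise the left entry, the minimum 0 and the right entry would form 312. -/
theorem lt_of_not_contains_perm312 {σ : Equiv.Perm (Fin (a + b + 1))}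
    (hσ : ¬ Contains perm312 σ) (h0 : σ (midPos a b) = 0) (i : Fin a) (j : Fin b) :
    σ (leftPos a b i) < σ (rightPos a b j) := by
  by_contra hlt
  refine hσ (contains_perm312_iff.2 ⟨leftPos a b i, midPos a b, rightPos a b j, ?_, ?_, ?_, ?_⟩)
  · rw [Fin.lt_def]; simp
  · rw [Fin.lt_def]; simp; omega
  · rw [h0, Fin.pos_iff_ne_zero, ← h0, σ.injective.ne_iff]
    exact rightPos_ne_midPos j
  · refine lt_of_le_of_ne (not_lt.1 hlt) ?_
    rw [σ.injective.ne_iff]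
    exact rightPos_ne_leftPos j i

theorem exists_eq_glue {σ : Equiv.Perm (Fin (a + b + 1))}
    (hσ : ¬ Contains perm312 σ) (h0 : σ (midPos a b) = 0) : ∃ α β, σ = glue α β := by
  have hlt := lt_of_not_contains_perm312 hσ h0
  have hlpos : ∀ i, 0 < (σ (leftPos a b i)).1 := by
    intro i
    have : σ (leftPos a b i) ≠ 0 := by
      rw [← h0, σ.injective.ne_iff]
      exact leftPos_ne_midPos i
    exact Nat.pos_of_ne_zero fun h => this (Fin.ext h)
  have hrpos : ∀ i, 0 < (σ (rightPos a b i)).1 := by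
    intro i
    have : σ (rightPos a b i) ≠ 0 := by
      rw [← h0, σ.injective.ne_iff]
      exact rightPos_ne_midPos i
    exact Nat.pos_of_ne_zero fun h => this (Fin.ext h)
  -- All `b` right values lie above a given left value, which bounds it by `a`. Dually, all `a` left
  -- values lie strictly between 0 and a given right value.
  have hl : ∀ i, (σ (leftPos a b i)).1 ≤ a := by
    intro i
    have hsub : univ.map ((rightPos a b).trans σ.toEmbedding) ⊆ Ioi (σ (leftPos a b i)) := by
      intro y hy
      obtain ⟨j, -, rfl⟩ := mem_map.1 hy
      exact mem_Ioi.2 (hlt i j)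
    have := card_le_card hsub
    rw [card_map, card_univ, Fintype.card_fin, Fin.card_Ioi] at this
    omega
  have hr : ∀ j, a < (σ (rightPos a b j)).1 := by
    intro j
    have hsub : univ.map ((leftPos a b).trans σ.toEmbedding) ⊆ Ioo 0 (σ (rightPos a b j)) := by
      intro y hy
      obtain ⟨i, -, rfl⟩ := mem_map.1 hy
      exact mem_Ioo.2 ⟨Fin.lt_def.2 (hlpos i), hlt i j⟩
    have := card_le_card hsub
    rw [card_map, card_univ, Fintype.card_fin, Fin.card_Ioo] at this
    have := hrpos j
    rw [Fin.val_zero] at *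
    omega
  let f : Fin a → Fin a := fun i => ⟨(σ (leftPos a b i)).1 - 1, by
    have := hl i; have := hlpos i; omega⟩
  let g : Fin b → Fin b := fun i => ⟨(σ (rightPos a b i)).1 - (a + 1), by
    have := (σ (rightPos a b i)).2; have := hr i; omega⟩
  have hf : Function.Injective f := by
    intro i j h
    have h := congrArg Fin.val h
    have h1 := hlpos i
    have h2 := hlpos j
    exact (leftPos a b).injective (σ.injective (Fin.ext (by simp only [f] at h; omega)))
  have hg : Function.Injective g := by
    intro i j h
    have h := congrArg Fin.val h
    have h1 := hr i
    have h2 := hr j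
    exact (rightPos a b).injective (σ.injective (Fin.ext (by simp only [g] at h; omega)))
  refine ⟨Equiv.ofBijective f (Finite.injective_iff_bijective.1 hf),
    Equiv.ofBijective g (Finite.injective_iff_bijective.1 hg), ?_⟩
  ext i
  rcases pos_cases i with ⟨i, rfl⟩ | rfl | ⟨i, rfl⟩
  · have := hlpos i
    simp only [val_glue_leftPos, Equiv.ofBijective_apply, f]
    omega
  · rw [h0, glue_midPos]
  · have := hr i
    simp only [val_glue_rightPos, Equiv.ofBijective_apply, g]
    omega

theorem lis_glue : lis (glue α β) = max (lis α) 1 + lis β := by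
  apply le_antisymm
  · obtain ⟨s, hs, hc⟩ := exists_card_eq_lis (glue α β)
    have hcov : s = ((univ.filter fun i => leftPos a b i ∈ s).map (leftPos a b) ∪
        s.filter (· = midPos a b)) ∪
        (univ.filter fun i => rightPos a b i ∈ s).map (rightPos a b) := by
      ext i
      rcases pos_cases i with ⟨i, rfl⟩ | rfl | ⟨i, rfl⟩
      · simp [leftPos_ne_midPos, rightPos_ne_leftPos]
      · simp [leftPos_ne_midPos, rightPos_ne_midPos]
      · simp [rightPos_ne_midPos, (rightPos_ne_leftPos _ _).symm]
    have hL : (univ.filter fun i => leftPos a b i ∈ s).card ≤ lis α := by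
      apply card_le_lis
      intro i hi j hj hij
      have := hs (show leftPos a b i ∈ _ by simpa using hi)
        (show leftPos a b j ∈ _ by simpa using hj) (by simpa using hij)
      simpa using this
    have hR : (univ.filter fun i => rightPos a b i ∈ s).card ≤ lis β := by
      apply card_le_lis
      intro i hi j hj hij
      have := hs (show rightPos a b i ∈ _ by simpa using hi)
        (show rightPos a b j ∈ _ by simpa using hj) (by simpa using hij)
      simpa using this
    have hLM : ((univ.filter fun i => leftPos a b i ∈ s).map (leftPos a b) ∪
        s.filter (· = midPos a b)).card ≤ max (lis α) 1 := by
      -- The value at the middle is 0, below everything to its left, so an increasing set through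
      -- the middle contains no left position.
      by_cases hm : midPos a b ∈ s
      · have : (univ.filter fun i => leftPos a b i ∈ s) = ∅ := by
          rw [filter_eq_empty_iff]
          intro i _ hi
          have := hs (mem_coe.2 hi) (mem_coe.2 hm) (by simp [Fin.lt_def])
          simp at this
        rw [this, map_empty, empty_union]
        refine le_trans (card_le_one.2 ?_) (le_max_right _ _)
        intro x hx y hy
        rw [(mem_filter.1 hx).2, (mem_filter.1 hy).2]
      · have : s.filter (· = midPos a b) = ∅ := by
          rw [filter_eq_empty_iff]
          rintro i hi rfl
          exact hm hi
        rw [this, union_empty, card_map]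
        exact hL.trans (le_max_left _ _)
    rw [← hc, hcov]
    refine (card_union_le _ _).trans (add_le_add hLM ?_)
    rwa [card_map]
  · obtain ⟨t, ht, htc⟩ := exists_card_eq_lis β
    -- Everything in `u` lies weakly below and to the left of `a`, so an increasing set of `β` can
    -- be appended. It is used with `u` the middle position or a longest increasing set of `α`.
    have key : ∀ u : Finset (Fin (a + b + 1)), StrictMonoOn (glue α β) (u : Set _) →
        (∀ i ∈ u, i.1 ≤ a ∧ (glue α β i).1 ≤ a) → u.card + t.card ≤ lis (glue α β) := by
      intro u hu hua
      have hd : Disjoint u (t.map (rightPos a b)) := by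
        rw [disjoint_left]
        intro i hi hi'
        obtain ⟨j, -, rfl⟩ := mem_map.1 hi'
        have := (hua _ hi).1
        simp at this
        omega
      rw [← card_map (rightPos a b), ← card_union_of_disjoint hd]
      apply card_le_lis
      intro i hi j hj hij
      simp only [coe_union, Set.mem_union, mem_coe] at hi hj
      rw [Fin.lt_def] at hij
      rcases hi with hi | hi <;> rcases hj with hj | hj
      · exact hu hi hj hij
      · obtain ⟨j, -, rfl⟩ := mem_map.1 hj
        have := (hua _ hi).2
        rw [Fin.lt_def, val_glue_rightPos]
        omega
      · obtain ⟨i, -, rfl⟩ := mem_map.1 hi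
        have := (hua _ hj).1
        rw [val_rightPos] at hij
        omega
      · obtain ⟨i, hi', rfl⟩ := mem_map.1 hi
        obtain ⟨j, hj', rfl⟩ := mem_map.1 hj
        have := ht (mem_coe.2 hi') (mem_coe.2 hj') (by simpa using hij)
        simpa using this
    rw [← htc]
    rcases le_total (lis α) 1 with h | h
    · rw [max_eq_right h]
      have := key {midPos a b} (by simp) (by simp)
      rwa [card_singleton] at this
    · rw [max_eq_left h]
      obtain ⟨s, hs, hsc⟩ := exists_card_eq_lis α
      rw [← hsc, ← card_map (leftPos a b)]
      apply key
      · intro i hi j hj hij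
        obtain ⟨i, hi', rfl⟩ := mem_map.1 (mem_coe.1 hi)
        obtain ⟨j, hj', rfl⟩ := mem_map.1 (mem_coe.1 hj)
        have := hs (mem_coe.2 hi') (mem_coe.2 hj') (by simpa using hij)
        simpa using this
      · intro i hi
        obtain ⟨i, -, rfl⟩ := mem_map.1 hi
        rw [val_leftPos, val_glue_leftPos]
        omega

end Glue

/-! ### Recurrence for the distribution of `lis` -/

theorem lis_eq_zero_iff {n : ℕ} {σ : Equiv.Perm (Fin n)} : lis σ = 0 ↔ n = 0 := by
  constructor
  · intro h
    by_contra hn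
    have := card_le_lis (σ := σ) (s := {⟨0, Nat.pos_of_ne_zero hn⟩}) (by simp)
    simp [h] at this
  · rintro rfl
    obtain ⟨s, -, hs⟩ := exists_card_eq_lis σ
    rw [← hs, card_eq_zero]
    exact Subsingleton.elim _ _

open Classical in
/-- The `312`-avoiding permutations of length `n`. -/
noncomputable def avoiders312 (n : ℕ) : Finset (Equiv.Perm (Fin n)) :=
  univ.filter fun σ => ¬ Contains perm312 σ

/-- The distribution of `lis` on the `312`-avoiding permutations of length `n`. -/
noncomputable def lisPoly (n : ℕ) : Polynomial ℚ := ∑ σ ∈ avoiders312 n, Polynomial.X ^ lis σ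

theorem mem_avoiders312 {n : ℕ} {σ : Equiv.Perm (Fin n)} :
    σ ∈ avoiders312 n ↔ ¬ Contains perm312 σ := by
  simp [avoiders312]

theorem lisPoly_zero : lisPoly 0 = 1 := by
  have : avoiders312 0 = {1} := by
    ext σ
    simp only [mem_avoiders312, contains_perm312_iff, mem_singleton, Subsingleton.elim σ 1,
      iff_true]
    rintro ⟨i, -⟩
    exact i.elim0
  rw [lisPoly, this, sum_singleton, lis_eq_zero_iff.2 rfl, pow_zero]

/-- The weight of `α` is `X ^ max (lis α) 1`; the maximum matters only for empty `α`, which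
contributes `X` instead of 1. -/
theorem sum_glue (a b : ℕ) :
    ∑ σ ∈ avoiders312 (a + b + 1) with σ (midPos a b) = 0, (Polynomial.X : Polynomial ℚ) ^ lis σ =
      (if a = 0 then Polynomial.X else lisPoly a) * lisPoly b := by
  have hw : (if a = 0 then Polynomial.X else lisPoly a) =
      ∑ α ∈ avoiders312 a, (Polynomial.X : Polynomial ℚ) ^ max (lis α) 1 := by
    split_ifs with h
    · subst h
      have := lisPoly_zero
      have h1 : ∀ α : Equiv.Perm (Fin 0), lis α = 0 := fun α => lis_eq_zero_iff.2 rfl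
      simp only [lisPoly, h1, pow_zero] at this
      simp only [h1, zero_le, max_eq_right, pow_one]
      calc (Polynomial.X : Polynomial ℚ) = (∑ _α ∈ avoiders312 0, 1) * Polynomial.X := by
            rw [this, one_mul]
        _ = _ := by rw [sum_mul]; simp only [one_mul]
    · refine sum_congr rfl fun α _ => ?_
      rw [max_eq_left (Nat.one_le_iff_ne_zero.2 (mt lis_eq_zero_iff.1 h))]
  rw [hw, lisPoly, sum_mul_sum, ← sum_product']
  symm
  refine sum_bij (fun p _ => glue p.1 p.2) ?_ ?_ ?_ ?_
  · rintro ⟨α, β⟩ h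
    simp only [mem_product, mem_avoiders312] at h
    simp [mem_avoiders312, contains_perm312_glue, h]
  · rintro ⟨α, β⟩ _ ⟨α', β'⟩ _ h
    obtain ⟨rfl, rfl⟩ := glue_injective h
    rfl
  · intro σ hσ
    rw [mem_filter, mem_avoiders312] at hσ
    obtain ⟨α, β, rfl⟩ := exists_eq_glue hσ.1 hσ.2
    refine ⟨(α, β), ?_, rfl⟩
    have := hσ.1
    rw [contains_perm312_glue, not_or] at this
    simpa [mem_avoiders312] using this
  · rintro ⟨α, β⟩ _
    rw [lis_glue, pow_add]

theorem lisPoly_succ (n : ℕ) :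
    lisPoly (n + 1) =
      ∑ p ∈ antidiagonal n, (if p.1 = 0 then Polynomial.X else lisPoly p.1) * lisPoly p.2 := by
  rw [lisPoly, Nat.sum_antidiagonal_eq_sum_range_succ_mk, sum_range,
    ← sum_fiberwise (avoiders312 (n + 1)) (fun σ => σ.symm 0)]
  refine sum_congr rfl fun p _ => ?_
  obtain ⟨a, ha⟩ := p
  obtain ⟨b, rfl⟩ : ∃ b, n = a + b := ⟨n - a, by omega⟩
  simp only [Nat.add_sub_cancel_left]
  rw [← sum_glue]
  refine sum_congr ?_ fun _ _ => rfl
  ext σ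
  simp only [mem_filter, Equiv.symm_apply_eq]
  exact and_congr_right fun _ => eq_comm

/-! ### Three-term recurrence for Narayana polynomials -/

/-- The Narayana polynomial `∑ₖ N(n, k + 1) Xᵏ` (with value `1` at `n = 0`), as a power series. -/
noncomputable def narayanaSeries (n : ℕ) : PowerSeries ℚ :=
  if n = 0 then 1 else PowerSeries.mk fun k => narayana n (k + 1)

theorem succ_mul_choose_succ (m k : ℕ) :
    ((k : ℚ) + 1) * (m.choose (k + 1) : ℚ) = ((m : ℚ) - k) * (m.choose k : ℚ) := by
  rcases le_or_gt k m with h | h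
  · have := Nat.choose_succ_right_eq m k
    rw [← Nat.cast_sub h]
    rw [mul_comm, mul_comm ((m - k : ℕ) : ℚ)]
    exact_mod_cast this
  · simp [Nat.choose_eq_zero_of_lt h, Nat.choose_eq_zero_of_lt (Nat.lt_succ_of_lt h)]

theorem choose_succ_eq_div (m k : ℕ) :
    (m.choose (k + 1) : ℚ) = ((m : ℚ) - k) * (m.choose k : ℚ) / ((k : ℚ) + 1) := by
  rw [eq_div_iff (by positivity), ← succ_mul_choose_succ, mul_comm]

/-- The coefficient of `X^(k+2)` in `narayanaSeries_three_term`. Every binomial reduces to a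
rational multiple of `(m+1).choose k`, leaving an identity of rational functions. -/
theorem narayana_three_term_add_two (m k : ℕ) :
    ((m : ℚ) + 4) * narayana (m + 3) (k + 3) =
      (2 * m + 5) * (narayana (m + 2) (k + 3) + narayana (m + 2) (k + 2)) -
        (m + 1) * (narayana (m + 1) (k + 3) - 2 * narayana (m + 1) (k + 2) +
          narayana (m + 1) (k + 1)) := by
  simp only [narayana, Nat.add_sub_cancel, show k + 3 - 1 = k + 2 by omega,
    show k + 2 - 1 = k + 1 by omega]
  rw [show m + 3 = (m + 1) + 1 + 1 by ring, show m + 2 = (m + 1) + 1 by ring,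
    show k + 3 = k + 1 + 1 + 1 by ring, show k + 2 = k + 1 + 1 by ring]
  simp only [Nat.choose_succ_succ (m + 1 + 1), Nat.choose_succ_succ (m + 1)]
  generalize hM : m + 1 = M
  have hm : (m : ℚ) = M - 1 := by rw [← hM]; push_cast; ring
  have hM0 : (M : ℚ) ≠ 0 := by rw [← hM]; positivity
  have hM1 : (M : ℚ) + 1 ≠ 0 := by positivity
  have hM2 : (M : ℚ) + 1 + 1 ≠ 0 := by positivity
  have h1 := choose_succ_eq_div M k
  have h2 := choose_succ_eq_div M (k + 1)
  have h3 := choose_succ_eq_div M (k + 1 + 1)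
  push_cast at h1 h2 h3 ⊢
  rw [h3, h2, h1, hm]
  field_simp
  ring

theorem narayana_three_term_one (m : ℕ) :
    ((m : ℚ) + 4) * narayana (m + 3) 2 =
      (2 * m + 5) * (narayana (m + 2) 2 + narayana (m + 2) 1) -
        (m + 1) * (narayana (m + 1) 2 - 2 * narayana (m + 1) 1) := by
  simp only [narayana, Nat.cast_choose_two]
  simp
  field_simp
  ring

theorem narayana_one (m : ℕ) : narayana (m + 1) 1 = 1 := by
  simp [narayana]
  field_simp

theorem narayanaSeries_three_term (m : ℕ) :
    ((m : PowerSeries ℚ) + 4) * narayanaSeries (m + 3) =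
      (2 * (m : PowerSeries ℚ) + 5) * ((1 + PowerSeries.X) * narayanaSeries (m + 2)) -
        ((m : PowerSeries ℚ) + 1) * ((1 - PowerSeries.X) ^ 2 * narayanaSeries (m + 1)) := by
  have e1 : ((m : PowerSeries ℚ) + 4) = PowerSeries.C ((m : ℚ) + 4) := by
    simp only [map_add, map_natCast, map_ofNat]
  have e2 : (2 * (m : PowerSeries ℚ) + 5) = PowerSeries.C (2 * (m : ℚ) + 5) := by
    simp only [map_add, map_mul, map_natCast, map_ofNat]
  have e3 : ((m : PowerSeries ℚ) + 1) = PowerSeries.C ((m : ℚ) + 1) := by simp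
  have e4 : (1 - PowerSeries.X : PowerSeries ℚ) ^ 2 * narayanaSeries (m + 1) =
      narayanaSeries (m + 1) - PowerSeries.C 2 * (PowerSeries.X * narayanaSeries (m + 1)) +
        PowerSeries.X * (PowerSeries.X * narayanaSeries (m + 1)) := by
    rw [map_ofNat]; ring
  rw [e1, e2, e3, e4, add_mul, one_mul]
  ext k
  rw [map_sub, PowerSeries.coeff_C_mul, PowerSeries.coeff_C_mul, PowerSeries.coeff_C_mul, map_add,
    map_add, map_sub, PowerSeries.coeff_C_mul]
  rcases k with _ | _ | k
  · simp [narayanaSeries, narayana_one]; ring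
  · have := narayana_three_term_one m
    simp only [PowerSeries.coeff_succ_X_mul, PowerSeries.coeff_zero_X_mul]
    simpa [narayanaSeries] using this
  · have := narayana_three_term_add_two m k
    simp only [PowerSeries.coeff_succ_X_mul]
    simpa [narayanaSeries] using this

theorem narayanaSeries_zero : narayanaSeries 0 = 1 := by simp [narayanaSeries]

theorem narayanaSeries_one : narayanaSeries 1 = 1 := by
  ext k
  rcases k with _ | k
  · simp [narayanaSeries, narayana]
  · simp [narayanaSeries, narayana, PowerSeries.coeff_one,
      Nat.choose_eq_zero_of_lt (show 1 < k + 1 + 1 by omega)]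

theorem narayanaSeries_two : narayanaSeries 2 = 1 + PowerSeries.X := by
  ext k
  rcases k with _ | _ | k
  · simp [narayanaSeries, narayana]
  · simp [narayanaSeries, narayana, PowerSeries.coeff_one, PowerSeries.coeff_X]
  · simp [narayanaSeries, narayana, PowerSeries.coeff_one, PowerSeries.coeff_X,
      Nat.choose_eq_zero_of_lt (show 2 < k + 1 + 1 + 1 by omega)]

/-! ### From the recurrence to the quadratic equation -/

open PowerSeries in
/-- The logarithmic derivative determines a power series up to its constant coefficient. -/
theorem eq_of_mul_derivative_eq {R : Type*} [CommRing R] [IsAddTorsionFree R]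
    {f g : PowerSeries R} (h : g * d⁄dX R f = f * d⁄dX R g)
    (hf : constantCoeff f = 1) (hg : constantCoeff g = 1) : f = g := by
  have hu : IsUnit g := by rw [isUnit_iff_constantCoeff, hg]; exact isUnit_one
  obtain ⟨u, rfl⟩ := hu
  have hc : constantCoeff (↑u⁻¹ : PowerSeries R) = 1 := by
    have := congrArg (constantCoeff (R := R)) u.mul_inv
    rw [map_mul, hg, one_mul, map_one] at this
    exact this
  have : f * ↑u⁻¹ = 1 := by
    apply derivative.ext
    · rw [(d⁄dX R).leibniz, derivative_inv, smul_eq_mul, smul_eq_mul,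
        (d⁄dX R).map_one_eq_zero]
      have hu : (u : PowerSeries R) * ↑u⁻¹ = 1 := u.mul_inv
      linear_combination (↑u⁻¹ : PowerSeries R) ^ 2 * h - ↑u⁻¹ * (d⁄dX R) f * hu
    · simp [hf, hc]
  calc f = f * ↑u⁻¹ * u := by rw [mul_assoc, u.inv_mul, mul_one]
    _ = u := by rw [this, one_mul]

section Quadratic
open PowerSeries

variable {R : Type*} [CommRing R]

/-- With `D = (1 - (1-x)X)^2 - 4xX` and `K = X ∑ H n X^n`, this is `D K' - (D'/2) K = 1 + (1-x)X`.
Here `D` is the discriminant of the expected quadratic; the recurrence gives the coefficients from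
`X^3` on, the initial values those below. -/
theorem ode_of_three_term (x : R) (H : ℕ → R) (h0 : H 0 = 1) (h1 : H 1 = 1) (h2 : H 2 = 1 + x)
    (h3 : ∀ n : ℕ, ((n : R) + 4) * H (n + 3) =
      (2 * (n : R) + 5) * ((1 + x) * H (n + 2)) - ((n : R) + 1) * ((1 - x) ^ 2 * H (n + 1))) :
    ((1 - X * C (1 - x)) ^ 2 - 4 * (X * C x)) * d⁄dX R (X * PowerSeries.mk H) -
        X * PowerSeries.mk H * (- C (1 + x) + X * C ((1 - x) ^ 2)) = 1 + C (1 - x) * X := by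
  have e : ((1 - X * C (1 - x)) ^ 2 - 4 * (X * C x)) * d⁄dX R (X * PowerSeries.mk H) -
        X * PowerSeries.mk H * (- C (1 + x) + X * C ((1 - x) ^ 2)) =
      d⁄dX R (X * PowerSeries.mk H) - C (2 * (1 + x)) * (X * d⁄dX R (X * PowerSeries.mk H)) +
       C ((1 - x) ^ 2) * (X * (X * d⁄dX R (X * PowerSeries.mk H))) +
       C (1 + x) * (X * PowerSeries.mk H) - C ((1 - x) ^ 2) * (X * (X * PowerSeries.mk H)) := by
    simp only [map_sub, map_mul, map_add, map_one, map_pow, map_ofNat]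
    ring
  rw [e]
  ext n
  rw [map_sub, map_add (coeff n), map_add (coeff n), map_sub, map_add (coeff n), coeff_C_mul, coeff_C_mul, coeff_C_mul,
    coeff_C_mul, coeff_C_mul]
  rcases n with _ | _ | _ | n
  · simp [h0]
  · simp [coeff_derivative, coeff_succ_X_mul, coeff_one, h0, h1]
    ring
  · simp [coeff_derivative, coeff_succ_X_mul, coeff_one, coeff_X, h0, h1, h2]
    ring
  · simp [coeff_derivative, coeff_succ_X_mul, coeff_one, coeff_X]
    linear_combination h3 n

theorem quadratic_of_three_term [IsDomain R] [CharZero R] [IsAddTorsionFree R] (x : R)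
    (hx : x ≠ 0) (H : ℕ → R) (h0 : H 0 = 1) (h1 : H 1 = 1) (h2 : H 2 = 1 + x)
    (h3 : ∀ n : ℕ, ((n : R) + 4) * H (n + 3) =
      (2 * (n : R) + 5) * ((1 + x) * H (n + 2)) - ((n : R) + 1) * ((1 - x) ^ 2 * H (n + 1))) :
    PowerSeries.mk H =
      1 + X * (C (1 - x) * PowerSeries.mk H + C x * (PowerSeries.mk H * PowerSeries.mk H)) := by
  have hode := ode_of_three_term x H h0 h1 h2 h3
  set f := PowerSeries.mk H
  -- The differential equation makes `Y = 1 - (1-x)X - 2xXf` satisfy `2 D Y' = D' Y`. So `Y^2` and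
  -- `D` have equal logarithmic derivatives and constant term 1, hence coincide; completing the
  -- square gives the quadratic.
  have hYY : (1 - X * C (1 - x) - 2 * C x * (X * f)) ^ 2 =
      (1 - X * C (1 - x)) ^ 2 - 4 * (X * C x) := by
    have hX : d⁄dX R X = 1 := derivative_X
    have hn2 : d⁄dX R (2 : PowerSeries R) = 0 := (d⁄dX R).map_natCast 2
    have hn4 : d⁄dX R (4 : PowerSeries R) = 0 := (d⁄dX R).map_natCast 4
    apply eq_of_mul_derivative_eq
    · generalize X * f = K at hode
      simp only [Derivation.leibniz_pow, map_sub, Derivation.leibniz, smul_eq_mul, derivative_C,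
        hX, hn2, hn4, Derivation.map_one_eq_zero, map_one, map_add, map_pow,
        nsmul_eq_mul] at hode ⊢
      push_cast
      linear_combination (-4 * C x * (1 - X * (1 - C x) - 2 * C x * K)) * hode
    · simp
    · simp
  have h4 : (4 * (X * C x) : PowerSeries R) ≠ 0 := by
    have h4R : (4 : R) * x ≠ 0 := mul_ne_zero (by norm_num) hx
    have : (4 * (X * C x) : PowerSeries R) = X * C (4 * x) := by
      rw [map_mul, map_ofNat]; ring
    rw [this]
    refine mul_ne_zero X_ne_zero ?_
    rwa [Ne, map_eq_zero_iff _ C_injective]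
  apply mul_left_cancel₀ (mul_ne_zero h4 X_ne_zero)
  simp only [map_sub, map_one] at hYY ⊢
  linear_combination (-X) * hYY

theorem narayanaSeries_succ (n : ℕ) :
    narayanaSeries (n + 1) = (1 - X) * narayanaSeries n +
      X * ∑ p ∈ antidiagonal n, narayanaSeries p.1 * narayanaSeries p.2 := by
  have : CharZero (PowerSeries ℚ) := algebraRat.charZero _
  have : IsAddTorsionFree (PowerSeries ℚ) := inferInstance
  -- The coefficient ring is itself `PowerSeries ℚ`: its variable is the parameter `x`, and the
  -- outer variable marks the index `n`.
  have := congrArg (coeff (n + 1)) (quadratic_of_three_term (X : PowerSeries ℚ) X_ne_zero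
    narayanaSeries narayanaSeries_zero narayanaSeries_one narayanaSeries_two
    narayanaSeries_three_term)
  rw [map_add, coeff_succ_X_mul, map_add, coeff_C_mul, coeff_C_mul, coeff_mul, coeff_one,
    if_neg n.succ_ne_zero, zero_add] at this
  simpa only [coeff_mk] using this

end Quadratic

/-! ### Generating functions for fixed `lis` -/

/-- The generating function of the `312`-avoiding permutations whose longest increasing
subsequence has length `j`. -/
noncomputable def lisSeries (j : ℕ) : PowerSeries ℚ :=
  PowerSeries.mk fun n => (lisPoly n).coeff j

theorem coeff_lisPoly (n j : ℕ) :
    (lisPoly n).coeff j = ∑ σ ∈ avoiders312 n, if lis σ = j then (1 : ℚ) else 0 := by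
  simp only [lisPoly, Polynomial.finsetSum_coeff, Polynomial.coeff_X_pow, eq_comm]


theorem lisSeries_zero : lisSeries 0 = 1 := by
  ext n
  rw [lisSeries, PowerSeries.coeff_mk, coeff_lisPoly, PowerSeries.coeff_one]
  simp only [lis_eq_zero_iff]
  split_ifs with h
  · subst h
    have := congrArg (Polynomial.coeff · 0) lisPoly_zero
    simp only [coeff_lisPoly, lis_eq_zero_iff] at this
    simpa using this
  · simp

open PowerSeries in
theorem lisSeries_succ (j : ℕ) :
    lisSeries (j + 1) = X * lisSeries j +
      X * ∑ p ∈ antidiagonal j, lisSeries (p.1 + 1) * lisSeries p.2 := by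
  have h0 : ∀ k, coeff 0 (lisSeries (k + 1)) = 0 := by
    intro k
    simp [lisSeries, lisPoly_zero, Polynomial.coeff_one]
  -- The correction at `a = 0`, `k = 0` is the empty `α`; it produces the term `X * lisSeries j`.
  -- The absence of a constant term (`hw0`) shifts the index in the convolution.
  have hw : ∀ a k, (if a = 0 then Polynomial.X else lisPoly a).coeff (k + 1) =
      coeff a (lisSeries (k + 1)) + if a = 0 ∧ k = 0 then 1 else 0 := by
    intro a k
    by_cases ha : a = 0
    · subst ha
      rw [h0, if_pos rfl, Polynomial.coeff_X, zero_add]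
      congr 1
      simp
    · simp [ha, lisSeries]
  have hw0 : ∀ a, (if a = 0 then Polynomial.X else lisPoly a).coeff 0 = 0 := by
    intro a
    split_ifs with ha
    · simp
    · have := congrArg (coeff a) lisSeries_zero
      simpa [lisSeries, coeff_one, ha] using this
  ext n
  rcases n with _ | n
  · rw [h0, map_add, coeff_zero_X_mul, coeff_zero_X_mul, add_zero]
  rw [← mul_add, coeff_succ_X_mul, map_add, map_sum]
  simp only [coeff_mul]
  rw [lisSeries, coeff_mk, lisPoly_succ, Polynomial.finsetSum_coeff]
  simp only [Polynomial.coeff_mul]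
  simp only [Nat.sum_antidiagonal_succ, hw, hw0, zero_mul, zero_add, add_mul, sum_add_distrib]
  rw [add_comm]
  congr 1
  swap
  · rw [sum_comm]
    simp [lisSeries]
  rw [sum_eq_single (0, n), sum_eq_single (0, j)]
  · simp [lisSeries]
  · rintro ⟨a, b⟩ hp hne
    have : a ≠ 0 := by
      rintro rfl
      simp at hp
      exact hne (by subst hp; rfl)
    simp [this]
  · simp
  · rintro ⟨a, b⟩ hp hne
    have : a ≠ 0 := by
      rintro rfl
      simp at hp
      exact hne (by subst hp; rfl)
    simp [this]
  · simp

open PowerSeries in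
theorem lisSeries_mul_pow (j : ℕ) :
    lisSeries (j + 1) * (1 - X) ^ (2 * j + 1) = X ^ (j + 1) * narayanaSeries j := by
  induction j using Nat.strong_induction_on with
  | _ j ih =>
  rcases j with _ | j
  · have := lisSeries_succ 0
    simp [lisSeries_zero] at this
    simp [narayanaSeries_zero]
    linear_combination this
  · have hrec : (1 - X) * lisSeries (j + 1 + 1) = X * lisSeries (j + 1) +
        X * ∑ p ∈ antidiagonal j, lisSeries (p.1 + 1) * lisSeries (p.2 + 1) := by
      have := lisSeries_succ (j + 1)
      -- The term with `p.2 = 0` is the unknown `lisSeries (j + 2)` itself; moved to the left it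
      -- creates the factor `1 - X`.
      rw [Nat.sum_antidiagonal_succ'] at this
      rw [lisSeries_zero] at this
      linear_combination this
    have hsum : (∑ p ∈ antidiagonal j, lisSeries (p.1 + 1) * lisSeries (p.2 + 1)) *
        (1 - X) ^ (2 * j + 2) =
        X ^ (j + 2) * ∑ p ∈ antidiagonal j, narayanaSeries p.1 * narayanaSeries p.2 := by
      rw [sum_mul, mul_sum]
      refine sum_congr rfl fun p hp => ?_
      have hp := mem_antidiagonal.1 hp
      have h1 := ih p.1 (by omega)
      have h2 := ih p.2 (by omega)
      -- The exponents `2j+1` and `j+1` split so that each factor absorbs exactly what its induction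
      -- hypothesis needs.
      rw [← hp, show 2 * (p.1 + p.2) + 2 = (2 * p.1 + 1) + (2 * p.2 + 1) by ring,
        show p.1 + p.2 + 2 = (p.1 + 1) + (p.2 + 1) by ring, pow_add, pow_add X,
        mul_mul_mul_comm, h1, h2]
      ring
    have h1 := ih j (by omega)
    rw [narayanaSeries_succ]
    calc lisSeries (j + 1 + 1) * (1 - X) ^ (2 * (j + 1) + 1)
        = (1 - X) * lisSeries (j + 1 + 1) * (1 - X) ^ (2 * j + 2) := by ring
      _ = X * (1 - X) * (lisSeries (j + 1) * (1 - X) ^ (2 * j + 1)) +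
          X * ((∑ p ∈ antidiagonal j, lisSeries (p.1 + 1) * lisSeries (p.2 + 1)) *
            (1 - X) ^ (2 * j + 2)) := by rw [hrec]; ring
      _ = _ := by rw [h1, hsum]; ring

/-! ### Assembling the formula -/

theorem avoiders_increasing (m n : ℕ) :
    avoiders (increasing m) n = (avoiders312 n).filter (lis · < m) := by
  ext σ
  simp [avoiders, avoiders312, contains_increasing_iff]

theorem F_increasing (m : ℕ) :
    F (increasing m) =
      ∑ j ∈ range m, q ^ j * PowerSeries.map Polynomial.C (lisSeries j) := by
  ext n i
  rw [F, PowerSeries.coeff_mk, avoiders_increasing, map_sum, Polynomial.finsetSum_coeff,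
    Polynomial.finsetSum_coeff]
  have h : ∀ j, ((PowerSeries.coeff n) (q ^ j * PowerSeries.map Polynomial.C (lisSeries j))).coeff i =
      if i = j then (lisPoly n).coeff j else 0 := by
    intro j
    rw [q, ← map_pow, PowerSeries.coeff_C_mul, PowerSeries.coeff_map, Polynomial.coeff_mul_C,
      Polynomial.coeff_X_pow, lisSeries, PowerSeries.coeff_mk, ite_mul, one_mul, zero_mul]
  simp only [h, sum_ite_eq, mem_range, coeff_lisPoly, Polynomial.coeff_X_pow, sum_filter]
  split_ifs with hi
  · refine sum_congr rfl fun σ _ => ?_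
    split_ifs <;> first | rfl | omega
  · refine sum_eq_zero fun σ _ => ?_
    split_ifs <;> first | rfl | omega

theorem map_narayanaSeries {j : ℕ} (hj : j ≠ 0) :
    PowerSeries.map Polynomial.C (narayanaSeries j) =
      ∑ k ∈ Icc 1 j, narayana j k • x ^ (k - 1) := by
  ext1 n
  rw [PowerSeries.coeff_map, narayanaSeries, if_neg hj, PowerSeries.coeff_mk, map_sum]
  have h : ∀ k ∈ Icc 1 j, (PowerSeries.coeff n) (narayana j k • x ^ (k - 1)) =
      if k = n + 1 then Polynomial.C (narayana j (n + 1)) else 0 := by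
    intro k hk
    have := (mem_Icc.1 hk).1
    rw [PowerSeries.coeff_smul, x, PowerSeries.coeff_X_pow]
    by_cases hkn : k = n + 1
    · subst hkn
      simp [Polynomial.smul_eq_C_mul]
    · rw [if_neg (by omega), if_neg hkn, smul_zero]
  rw [sum_congr rfl h, sum_ite_eq']
  split_ifs with hn
  · rfl
  · rw [narayana, Nat.choose_eq_zero_of_lt (by simp at hn; omega)]
    simp

theorem map_lisSeries_succ (j : ℕ) :
    PowerSeries.map Polynomial.C (lisSeries (j + 1)) =
      x ^ (j + 1) * Ring.inverse ((1 - x) ^ (2 * j + 1)) *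
        PowerSeries.map Polynomial.C (narayanaSeries j) := by
  have h := congrArg (PowerSeries.map (Polynomial.C (R := ℚ))) (lisSeries_mul_pow j)
  simp only [map_mul, map_pow, map_sub, map_one, PowerSeries.map_X] at h
  have hu : IsUnit ((1 - x) ^ (2 * j + 1)) := isUnit_one_sub_x.pow _
  rw [mul_right_comm, x, ← h, ← x, mul_assoc, Ring.mul_inverse_cancel _ hu, mul_one]

end PatternAvoidance

open PatternAvoidance in
theorem corollary3p1 :
    PatternAvoidance.F (PatternAvoidance.increasing 1) = 1 ∧
    ∀ m : ℕ, 2 ≤ m →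
      PatternAvoidance.F (PatternAvoidance.increasing m) =
        1 + PatternAvoidance.q * PatternAvoidance.x * Ring.inverse (1 - PatternAvoidance.x) +
          ∑ j ∈ Finset.Icc 2 (m - 1),
            PatternAvoidance.q ^ j * PatternAvoidance.x ^ j *
                Ring.inverse ((1 - PatternAvoidance.x) ^ (2 * j - 1)) *
              ∑ k ∈ Finset.Icc 1 (j - 1),
                PatternAvoidance.narayana (j - 1) k • PatternAvoidance.x ^ (k - 1) := by
  constructor
  · simp [F_increasing, lisSeries_zero]
  · intro m hm
    obtain ⟨m, rfl⟩ : ∃ k, m = k + 2 := ⟨m - 2, by omega⟩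
    have hI : Finset.Icc 2 (m + 2 - 1) = Finset.Ico 2 (m + 2) := by
      ext j; simp only [Finset.mem_Icc, Finset.mem_Ico]; omega
    have h1 : PowerSeries.map Polynomial.C (lisSeries (0 + 1)) = x * Ring.inverse (1 - x) := by
      rw [map_lisSeries_succ, narayanaSeries_zero, map_one, mul_one, zero_add, pow_one, mul_zero,
        zero_add, pow_one]
    -- The terms `j = 0` and `j = 1` are split off: they give `1` and `qx/(1-x)`, the latter through
    -- the convention that the Narayana polynomial of index 0 is 1.
    rw [F_increasing, hI, Finset.sum_Ico_eq_sum_range, Finset.sum_range_succ',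
      Finset.sum_range_succ', lisSeries_zero, h1, map_one, mul_one, pow_zero, zero_add, pow_one,
      ← mul_assoc, add_assoc, add_comm, add_comm (q * x * _) 1, Nat.add_sub_cancel]
    refine congrArg₂ (· + ·) rfl ?_
    refine Finset.sum_congr rfl fun j _ => ?_
    rw [show 2 + j - 1 = j + 1 by omega, ← map_narayanaSeries (Nat.succ_ne_zero j),
      map_lisSeries_succ, show 2 + j = j + 1 + 1 by ring,
      show 2 * (j + 1 + 1) - 1 = 2 * (j + 1) + 1 by omega]
    ring
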